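/- Setting. Let $\mathbb T_n$ be the $n$-regular tree with edges labelled by $[1,n]$. A cluster ensemble $(\mathcal A,\mathcal X,p)$ of rank $n$ with trivial coefficients has a matrix pattern $\{B_t\}_{t\in\mathbb T_n}$ of skew-symmetrizable integer matrices $B_t=(b_{i,j})$, with $B_{t'}=\mu_k(B_t)$ on every edge $t\overset{k}{-}t'$. Its clusters ${\bf x}_t$, ${\bf y}_t$ are related along such an edge by $x_{t';k}=x_{t;k}^{-1}\bigl(\prod_j x_{t;j}^{[b_{j,k}]_+}+\prod_j x_{t;j}^{[-b_{j,k}]_+}\bigr)$, $y_{t';k}=y_{t;k}^{-1}$ and, for $i\ne k$, $x_{t';i}=x_{t;i}$, $y_{t';i}=y_{t;i}\,y_{t;k}^{[b_{k,i}]_+}(1+y_{t;k})^{-b_{k,i}}$. The ensemble map satisfies $p^*({\bf y}_t)={\bf x}_t^{B_t}$ for all $t$. Let $\mathcal A_{>0}$, $\mathcal X_{>0}$ be the sets of $\mathbb R_{>0}$-valued points of $\mathcal A$, $\mathcal X$ (all cluster variables, respectively all $y$-variables, take positive values). The ensemble is of finite type, i.e. of the Cartan–Killing type of a finite root system, if for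 some $t$ the Cartan companion of $B_t$ (diagonal entries $2$, off-diagonal entries $-|b_{i,j}|$) is a Cartan matrix of finite type (integer entries, diagonal entries $2$, off-diagonal entries $\le 0$, positive definite after symmetrization; it may be decomposable). For a Cartan matrix $A=(a_{i,j})$ of finite type let $B_A$ be the matrix with entries $0$ for $i=j$, $-a_{i,j}$ for $i>j$ and $a_{i,j}$ for $i<j$. A triple $(t_0,t_1,\sigma)$ with $\sigma\in S_n$ is a reddening triple if mutation along the path from $t_0$ to $t_1$ carries the extended matrix $\binom{B_{t_0}}{I_n}$ to $\binom{\overline\sigma B_{t_0}\overline\sigma^{-1}}{-\overline\sigma^{-1}}$, where $\overline\sigma=(e_{\sigma(1)},\ldots,e_{\sigma(n)})$. The DT transformations given by it are determined by $\mathrm{DT}_{\mathcal A}^*(x_{t;i})=x_{t[1];\sigma(i)}$ and $\mathrm{DT}_{\mathcal X}^*(y_{t;i})=y_{t[1];\sigma(i)}$ for all $t$ and $i$, where $t\mapsto t[1]$ is the tree isomorphism that sends $t_0$ to $t_1$ and edges labelled $k$ to edges labelled $\sigma(k)$. Theorem A. Let $(\mathcal A,\mathcal X,p)$ be a cluster ensemble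 of finite type, with trivial coefficients. Then there are a vertex $t_0$, a relabelling $\pi\in S_n$ and a Cartan matrix $A=(a_{i,j})$ of finite type such that $B_{t_0}$ is $B_A$ after relabelling, i.e. $(B_{t_0})_{\pi(i),\pi(j)}=(B_A)_{i,j}$ for all $i,j$. For any such $t_0,\pi,A$, let $t_0[1]$ be the end point of the path that starts at $t_0$ and has successive labels $\pi(1),\ldots,\pi(n)$. Then $(t_0,t_0[1],\mathrm{id})$ is a reddening triple, and for the DT transformations $\mathrm{DT}_{\mathcal A}$, $\mathrm{DT}_{\mathcal X}$ that it gives the following hold. 1. $\mathrm{DT}_{\mathcal A}$ has a unique fixed point ${\bf a}$ in $\mathcal A_{>0}$, $\mathrm{DT}_{\mathcal X}$ has a unique fixed point ${\bf b}$ in $\mathcal X_{>0}$, and $p({\bf a})={\bf b}$. 2. Write $x_i=x_{t_0;\pi(i)}$ and $y_i=y_{t_0;\pi(i)}$, and define recursively $Y_i=y_i\prod_{j<i}(1+Y_j)^{-a_{j,i}}$. The map $(x_1,\ldots,x_n)$ restricts to a bijection from the fixed points of $\mathrm{DT}_{\mathcal A}$ in $\mathcal A_{>0}$ onto the solutions in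 $(\mathbb R_{>0})^n$ of $$a_i^2=1+\prod_{j\ne i}a_j^{-a_{j,i}},\qquad i\in[1,n],$$ and $(Y_1,\ldots,Y_n)$ restricts to a bijection from the fixed points of $\mathrm{DT}_{\mathcal X}$ in $\mathcal X_{>0}$ onto the solutions in $(\mathbb R_{>0})^n$ of $$b_i^2=\prod_{j\ne i}(1+b_j)^{-a_{j,i}},\qquad i\in[1,n].$$ If $(a_1,\ldots,a_n)$ is a positive solution of the first system, then $(a_1^2-1,\ldots,a_n^2-1)$ is a positive solution of the second. 3. Each of the two systems has exactly one solution in $(\mathbb R_{>0})^n$. -/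

import Mathlib

namespace ClusterDT

/-! ### Matrices and mutation -/

/-- Matrix mutation in direction `k` of an (extended) matrix with columns indexed by `Fin n` and rows
indexed by `ι`; the map `e` says which rows form the principal part (`e = id` for a square matrix,
`e = Sum.inl` for a matrix with additional rows). -/
def matMutate {n : ℕ} {ι : Type} [DecidableEq ι] (e : Fin n → ι) (k : Fin n)
    (M : Matrix ι (Fin n) ℤ) : Matrix ι (Fin n) ℤ :=
  Matrix.of fun i j =>
    if i = e k ∨ j = k then - M i j
    else M i j + max (M i k) 0 * max (M (e k) j) 0 - max (-M i k) 0 * max (-M (e k) j) 0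

/-- Successive mutation along a list of directions (the head of the list is applied first). -/
def matMutateList {n : ℕ} {ι : Type} [DecidableEq ι] (e : Fin n → ι) (w : List (Fin n))
    (M : Matrix ι (Fin n) ℤ) : Matrix ι (Fin n) ℤ :=
  w.foldl (fun N k => matMutate e k N) M

/-- `B` is skew-symmetrizable: `D B` is skew-symmetric for a diagonal matrix `D` with positive integer
diagonal entries. -/
def IsSkewSymmetrizable {n : ℕ} (B : Matrix (Fin n) (Fin n) ℤ) : Prop :=
  ∃ d : Fin n → ℤ, (∀ i, 0 < d i) ∧
    (Matrix.diagonal d * B).transpose = -(Matrix.diagonal d * B)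

/-- The permutation matrix `(e_{σ(1)}, …, e_{σ(n)})`. -/
def sigmaBar {n : ℕ} (σ : Equiv.Perm (Fin n)) : Matrix (Fin n) (Fin n) ℤ :=
  Matrix.of fun i j => if i = σ j then 1 else 0

/-- Cartan matrices of finite type (not necessarily indecomposable): the diagonal entries are `2`, the
off-diagonal entries are nonpositive integers, and the matrix is symmetrizable with positive definite
symmetrization. -/
def IsFiniteCartan {n : ℕ} (A : Matrix (Fin n) (Fin n) ℤ) : Prop :=
  (∀ i, A i i = 2) ∧ (∀ i j, i ≠ j → A i j ≤ 0) ∧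
    ∃ d : Fin n → ℤ, (∀ i, 0 < d i) ∧
      ((Matrix.diagonal d * A).map (Int.cast : ℤ → ℝ)).PosDef

/-- The Cartan companion of a mutation matrix. -/
def cartanCompanion {n : ℕ} (B : Matrix (Fin n) (Fin n) ℤ) : Matrix (Fin n) (Fin n) ℤ :=
  Matrix.of fun i j => if i = j then 2 else -|B i j|

/-- The mutation matrix `B_A` of a Cartan matrix `A`. -/
def cartanB {n : ℕ} (A : Matrix (Fin n) (Fin n) ℤ) : Matrix (Fin n) (Fin n) ℤ :=
  Matrix.of fun i j => if i = j then 0 else if j < i then -A i j else A i j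

/-! ### The `n`-regular tree -/

/-- The vertex set of the `n`-regular tree with edges labelled by `Fin n`, realized as the Cayley graph of
the free product of `n` copies of `ℤ/2`: the edge labelled `k` at `t` joins `t` and `t * gen k`. -/
abbrev Tree (n : ℕ) : Type := Monoid.CoprodI (fun _ : Fin n => Multiplicative (ZMod 2))

/-- The generator of the `k`-th factor. -/
def gen {n : ℕ} (k : Fin n) : Tree n :=
  Monoid.CoprodI.of (M := fun _ : Fin n => Multiplicative (ZMod 2)) (i := k) (Multiplicative.ofAdd 1)

/-- The element of the free product spelled by a list of labels, so that the path starting at `t` with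
successive labels `w` ends at `t * word w`. -/
def word {n : ℕ} (w : List (Fin n)) : Tree n := (w.map gen).prod

/-- The relabelling of edges by `σ`: it fixes the vertex `1` and sends edges labelled `k` to edges labelled
`σ k`. -/
def relabel {n : ℕ} (σ : Equiv.Perm (Fin n)) : Tree n →* Tree n :=
  Monoid.CoprodI.lift fun k =>
    Monoid.CoprodI.of (M := fun _ : Fin n => Multiplicative (ZMod 2)) (i := σ k)

/-- The vertex `t[1]`: the image of `t` under the unique tree isomorphism that sends `t₀` to `t₁` and edges
labelled `k` to edges labelled `σ k`. -/
def shift {n : ℕ} (t₀ t₁ : Tree n) (σ : Equiv.Perm (Fin n)) (t : Tree n) : Tree n :=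
  t₁ * relabel σ (t₀⁻¹ * t)

theorem relabel_gen {n : ℕ} (σ : Equiv.Perm (Fin n)) (k : Fin n) :
    relabel σ (gen k) = gen (σ k) := by
  simp [relabel, gen]

theorem shift_mul_gen {n : ℕ} (t₀ t₁ : Tree n) (σ : Equiv.Perm (Fin n)) (t : Tree n) (k : Fin n) :
    shift t₀ t₁ σ (t * gen k) = shift t₀ t₁ σ t * gen (σ k) := by
  simp [shift, ← relabel_gen, ← map_mul, mul_assoc]

theorem shift_self {n : ℕ} (t₀ t₁ : Tree n) (σ : Equiv.Perm (Fin n)) :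
    shift t₀ t₁ σ t₀ = t₁ := by
  simp [shift]

theorem tree_induction {n : ℕ} {P : Tree n → Prop} (t₀ : Tree n) (h0 : P t₀)
    (hs : ∀ t k, P t → P (t * gen k)) (t : Tree n) : P t := by
  have key : ∀ g : Tree n, ∀ s, P s → P (s * g) := by
    intro g
    induction g using Monoid.CoprodI.induction_on with
    | one => intro s hs; simpa using hs
    | of i m =>
      intro s h
      have hm : m = 1 ∨ m = Multiplicative.ofAdd 1 := by
        revert m; decide
      rcases hm with rfl | rfl
      · simpa using h
      · exact hs s i h
    | mul x y hx hy =>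
      intro s h
      rw [← mul_assoc]
      exact hy _ (hx _ h)
  simpa using key (t₀⁻¹ * t) t₀ h0

/-! ### Seed mutations of real points -/

/-- The mutation of cluster variables in direction `k`, in terms of the values of the variables. -/
noncomputable def mutA {n : ℕ} (B : Matrix (Fin n) (Fin n) ℤ) (k : Fin n) (x : Fin n → ℝ) :
    Fin n → ℝ := fun i =>
  if i = k then (x k)⁻¹ * (∏ j, x j ^ max (B j k) 0 + ∏ j, x j ^ max (-B j k) 0) else x i

/-- The mutation of `y`-variables in direction `k`, in terms of the values of the variables. -/
noncomputable def mutX {n : ℕ} (B : Matrix (Fin n) (Fin n) ℤ) (k : Fin n) (y : Fin n → ℝ) :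
    Fin n → ℝ := fun i =>
  if i = k then (y k)⁻¹ else y i * y k ^ max (B k i) 0 * (1 + y k) ^ (-B k i)

/-- The `ŷ`-variables `x ^ B`. -/
noncomputable def yHat {n : ℕ} (B : Matrix (Fin n) (Fin n) ℤ) (x : Fin n → ℝ) : Fin n → ℝ :=
  fun j => ∏ i, x i ^ B i j

theorem IsSkewSymmetrizable.diag {n : ℕ} {B : Matrix (Fin n) (Fin n) ℤ}
    (h : IsSkewSymmetrizable B) (k : Fin n) : B k k = 0 := by
  obtain ⟨d, hd, hB⟩ := h
  have h1 := congrFun (congrFun hB k) k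
  simp only [Matrix.transpose_apply, Matrix.neg_apply, Matrix.diagonal_mul] at h1
  have h2 : d k * B k k = 0 := by omega
  rcases mul_eq_zero.mp h2 with h3 | h3
  · exact absurd h3 (hd k).ne'
  · exact h3

theorem yHat_mutA {n : ℕ} {B : Matrix (Fin n) (Fin n) ℤ} (hB : IsSkewSymmetrizable B) (k : Fin n)
    {x : Fin n → ℝ} (hx : ∀ i, 0 < x i) :
    yHat (matMutate id k B) (mutA B k x) = mutX B k (yHat B x) := by
  have hkk := hB.diag k
  set P := ∏ j, x j ^ max (B j k) 0 with hP
  set Q := ∏ j, x j ^ max (-B j k) 0 with hQ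
  have hP0 : 0 < P := Finset.prod_pos fun j _ => zpow_pos (hx j) _
  have hQ0 : 0 < Q := Finset.prod_pos fun j _ => zpow_pos (hx j) _
  have hyk : yHat B x k = P / Q := by
    rw [hP, hQ, ← Finset.prod_div_distrib]
    refine Finset.prod_congr rfl fun i _ => ?_
    rw [← zpow_sub₀ (hx i).ne']
    congr 1
    omega
  funext j
  by_cases hj : j = k
  · subst hj
    simp only [mutX, if_pos]
    rw [yHat, yHat, ← Finset.prod_inv_distrib]
    refine Finset.prod_congr rfl fun i _ => ?_
    by_cases hi : i = j
    · subst hi; simp [matMutate, hkk]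
    · simp [matMutate, mutA, hi]
  · have hfac : ∀ i, mutA B k x i ^ (matMutate id k B i j) =
        x i ^ B i j * (x i ^ max (B i k) 0) ^ max (B k j) 0 *
          (x i ^ max (-B i k) 0) ^ (-max (-B k j) 0) *
          (if i = k then (P + Q) ^ (-B k j) else 1) := by
      intro i
      have hxi := (hx i).ne'
      by_cases hi : i = k
      · subst hi
        simp only [mutA, matMutate, Matrix.of_apply, id, if_true, true_or, hkk]
        rw [← hP, ← hQ, mul_zpow]
        simp
      · simp only [mutA, matMutate, Matrix.of_apply, id, hi, hj, or_self, if_false, mul_one]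
        rw [← zpow_mul, ← zpow_mul, ← zpow_add₀ hxi, ← zpow_add₀ hxi]
        congr 1
        ring
    have hL : yHat (matMutate id k B) (mutA B k x) j =
        yHat B x j * P ^ max (B k j) 0 * Q ^ (-max (-B k j) 0) * (P + Q) ^ (-B k j) := by
      rw [yHat, Finset.prod_congr rfl fun i _ => hfac i]
      simp only [Finset.prod_mul_distrib, Finset.prod_zpow, Finset.prod_ite_eq', Finset.mem_univ,
        if_true]
      rfl
    rw [hL]
    simp only [mutX, if_neg hj]
    rw [hyk]
    have h1 : 1 + P / Q = (P + Q) / Q := by field_simp; ring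
    rw [h1, div_zpow, div_zpow]
    have hm : -max (-B k j) 0 = -max (B k j) 0 - (-B k j) := by omega
    rw [hm, zpow_sub₀ hQ0.ne', zpow_neg]
    field_simp

theorem mutA_perm {n : ℕ} {B B' : Matrix (Fin n) (Fin n) ℤ} (σ : Equiv.Perm (Fin n))
    (h : ∀ i j, B' (σ i) (σ j) = B i j) (k : Fin n) (x : Fin n → ℝ) :
    (fun i => mutA B' (σ k) x (σ i)) = mutA B k (fun i => x (σ i)) := by
  funext i
  simp only [mutA, EmbeddingLike.apply_eq_iff_eq]
  rw [← Equiv.prod_comp σ (fun j => x j ^ max (B' j (σ k)) 0),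
    ← Equiv.prod_comp σ (fun j => x j ^ max (-B' j (σ k)) 0)]
  simp only [h]

theorem mutX_perm {n : ℕ} {B B' : Matrix (Fin n) (Fin n) ℤ} (σ : Equiv.Perm (Fin n))
    (h : ∀ i j, B' (σ i) (σ j) = B i j) (k : Fin n) (y : Fin n → ℝ) :
    (fun i => mutX B' (σ k) y (σ i)) = mutX B k (fun i => y (σ i)) := by
  funext i
  simp only [mutX, EmbeddingLike.apply_eq_iff_eq, h]

/-! ### Cluster ensembles -/

/-- A cluster ensemble of rank `n` with trivial coefficients, given by its matrix pattern (which determines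
the gluing of the tori of both varieties and the ensemble map): a skew-symmetrizable matrix `B t` at every
vertex of the tree, related by matrix mutation along every edge. -/
structure ClusterEnsemble (n : ℕ) where
  B : Tree n → Matrix (Fin n) (Fin n) ℤ
  skew : ∀ t, IsSkewSymmetrizable (B t)
  mutation : ∀ t k, B (t * gen k) = matMutate id k (B t)

namespace ClusterEnsemble

variable {n : ℕ} (E : ClusterEnsemble n)

/-- The positive real points of the cluster variety with the exchange relations of `x`-variables. A point is
recorded by the values `x t i` of all cluster variables `x_{t;i}`; they are positive and related by the
mutations, and any one cluster determines the point. -/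
@[ext]
structure APos where
  x : Tree n → Fin n → ℝ
  pos : ∀ t i, 0 < x t i
  mutation : ∀ t k, x (t * gen k) = mutA (E.B t) k (x t)

/-- The positive real points of the cluster Poisson variety, recorded by the values `y t i` of all
`y`-variables `y_{t;i}`. -/
@[ext]
structure XPos where
  y : Tree n → Fin n → ℝ
  pos : ∀ t i, 0 < y t i
  mutation : ∀ t k, y (t * gen k) = mutX (E.B t) k (y t)

/-- The ensemble map on positive points: `p^*(y_t) = x_t ^ B_t` for every `t`. -/
noncomputable def p (a : E.APos) : E.XPos where
  y t := yHat (E.B t) (a.x t)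
  pos t _ := Finset.prod_pos fun i _ => zpow_pos (a.pos t i) _
  mutation t k := by
    rw [E.mutation, a.mutation]
    exact yHat_mutA (E.skew t) k (a.pos t)

/-- `(t₀, t₁, σ)` is a reddening triple: mutating the extended matrix with principal part `B_{t₀}` and
coefficient part the identity along a path from `t₀` to `t₁` gives the extended matrix with principal part
`σ̄ B_{t₀} σ̄⁻¹` and coefficient part `-σ̄⁻¹`. -/
def IsReddeningTriple (t₀ t₁ : Tree n) (σ : Equiv.Perm (Fin n)) : Prop :=
  ∃ w : List (Fin n), t₁ = t₀ * word w ∧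
    matMutateList Sum.inl w (Matrix.fromRows (E.B t₀) (1 : Matrix (Fin n) (Fin n) ℤ)) =
      Matrix.fromRows (sigmaBar σ * E.B t₀ * sigmaBar σ⁻¹) (-sigmaBar σ⁻¹)

variable {E}

theorem toRows₁_matMutate {m : ℕ} (k : Fin n) (M : Matrix (Fin n ⊕ Fin m) (Fin n) ℤ) :
    (matMutate Sum.inl k M).toRows₁ = matMutate id k M.toRows₁ := by
  ext i j
  simp [matMutate, Matrix.toRows₁]

theorem B_word (t : Tree n) {m : ℕ} (w : List (Fin n)) (M : Matrix (Fin n ⊕ Fin m) (Fin n) ℤ)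
    (hM : M.toRows₁ = E.B t) :
    (matMutateList Sum.inl w M).toRows₁ = E.B (t * word w) := by
  induction w generalizing t M with
  | nil => simpa [matMutateList, word] using hM
  | cons k w ih =>
    have h := ih (t * gen k) (matMutate Sum.inl k M)
      (by rw [toRows₁_matMutate, hM, E.mutation])
    simpa [matMutateList, word, mul_assoc] using h

theorem IsReddeningTriple.B_shift {t₀ t₁ : Tree n} {σ : Equiv.Perm (Fin n)}
    (h : E.IsReddeningTriple t₀ t₁ σ) (t : Tree n) :
    ∀ i j, E.B (shift t₀ t₁ σ t) (σ i) (σ j) = E.B t i j := by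
  induction t using tree_induction t₀ with
  | h0 =>
    obtain ⟨w, rfl, hw⟩ := h
    intro i j
    rw [shift_self, ← B_word t₀ w _ (Matrix.toRows₁_fromRows _ _), hw, Matrix.toRows₁_fromRows]
    simp [Matrix.mul_apply, sigmaBar, Finset.sum_ite_eq]
  | hs t k ih =>
    intro i j
    rw [shift_mul_gen, E.mutation, E.mutation]
    simp [matMutate, ih]

/-- The cluster DT transformation of the positive points of the cluster variety, given by a reddening triple:
`DT^*(x_{t;i}) = x_{t[1];σ(i)}` for every `t`. -/
def DTA {t₀ t₁ : Tree n} {σ : Equiv.Perm (Fin n)} (h : E.IsReddeningTriple t₀ t₁ σ) (a : E.APos) :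
    E.APos where
  x t i := a.x (shift t₀ t₁ σ t) (σ i)
  pos _ _ := a.pos _ _
  mutation t k := by
    rw [← mutA_perm σ (h.B_shift t), shift_mul_gen, a.mutation]

/-- The cluster DT transformation of the positive points of the cluster Poisson variety, given by a reddening
triple: `DT^*(y_{t;i}) = y_{t[1];σ(i)}` for every `t`. -/
def DTX {t₀ t₁ : Tree n} {σ : Equiv.Perm (Fin n)} (h : E.IsReddeningTriple t₀ t₁ σ) (b : E.XPos) :
    E.XPos where
  y t i := b.y (shift t₀ t₁ σ t) (σ i)
  pos _ _ := b.pos _ _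
  mutation t k := by
    rw [← mutX_perm σ (h.B_shift t), shift_mul_gen, b.mutation]

variable (E)

/-- The ensemble is of finite type: the Cartan companion of some matrix of its matrix pattern is a Cartan
matrix of finite type. -/
def IsFiniteType : Prop := ∃ t, IsFiniteCartan (cartanCompanion (E.B t))

/-- `A` is a Cartan matrix of finite type and, after relabelling by `π`, the matrix at `t₀` is `B_A`. -/
def IsCartanSeed (t₀ : Tree n) (π : Equiv.Perm (Fin n)) (A : Matrix (Fin n) (Fin n) ℤ) : Prop :=
  IsFiniteCartan A ∧ ∀ i j, E.B t₀ (π i) (π j) = cartanB A i j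

end ClusterEnsemble

/-! ### The coordinates `Y` and the two systems of equations -/

/-- The coordinates `Y_i = y_i ∏_{j < i} (1 + Y_j) ^ (-a_{j,i})`, defined by recursion on `i`. -/
noncomputable def bigY {n : ℕ} (A : Matrix (Fin n) (Fin n) ℤ) (y : Fin n → ℝ) (i : Fin n) : ℝ :=
  y i * ∏ j : {j : Fin n // j < i}, (1 + bigY A y j.1) ^ (-A j.1 i)
termination_by i
decreasing_by exact j.2

/-- The positive solutions of `a_i² = 1 + ∏_{j ≠ i} a_j ^ (-a_{j,i})`. -/
def solA {n : ℕ} (A : Matrix (Fin n) (Fin n) ℤ) : Set (Fin n → ℝ) :=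
  {a | (∀ i, 0 < a i) ∧ ∀ i, a i ^ 2 = 1 + ∏ j ∈ Finset.univ.erase i, a j ^ (-A j i)}

/-- The positive solutions of `b_i² = ∏_{j ≠ i} (1 + b_j) ^ (-a_{j,i})`. -/
def solX {n : ℕ} (A : Matrix (Fin n) (Fin n) ℤ) : Set (Fin n → ℝ) :=
  {b | (∀ i, 0 < b i) ∧ ∀ i, b i ^ 2 = ∏ j ∈ Finset.univ.erase i, (1 + b j) ^ (-A j i)}

end ClusterDT

/-!
The seed `t₀`. When the Cartan companion of a skew-symmetrizable matrix `B` is of finite type, the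
arrows of `B` form an acyclic graph: a set of vertices that all have outgoing arrows inside the set
has at least as many edges as vertices, and the positive definite form would be nonpositive at its
normalized indicator function (`exists_forall_nonpos_of_isFiniteCartan`). Sorting the indices along
the arrows turns `B` into some `B_A` (`exists_perm_cartanB`).

The path to `t₀[1]`. Starting from `B_A`, the mutations in directions `1, …, n` take place at vertices
whose extended column is nonnegative and whose row is nonpositive, so they only change signs. This
gives the reddening triple (`IsCartanSeed.isReddeningTriple`), and it makes the mutation rules along
the path explicit: with primes denoting the values at `t₀[1]`,
`x'_i x_i = 1 + ∏_{j < i} x'_j ^ (-a_{j,i}) ∏_{j > i} x_j ^ (-a_{j,i})` (`IsCartanSeed.x_word_mul`) and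
`y'_i = Y_i⁻¹ ∏_{j > i} (1 + Y_j) ^ (-a_{j,i})` (`IsCartanSeed.y_word`). A positive point is determined
by any one of its clusters, which can be prescribed at will (`ext_cluster`, `exists_aPos`,
`exists_xPos`), so a DT transformation fixes a point exactly when the values at `t₀` and `t₀[1]` agree,
and this is the corresponding system of equations.

The systems. A solution of the first system exists by the Knaster–Tarski theorem, since the system
is the fixed point equation of a monotone map, for which `(1, …, 1)` is a subsolution and `2 ^ u` with
`Aᵀ u = (1, …, 1)` a supersolution (`solA_nonempty`). The second system has at most one solution,
because in the coordinates `log (1 + b_i)` it equates the gradient of a positive definite form to a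
map with decreasing components (`solX_subsingleton`). The substitution `b = a ^ 2 - 1` embeds the
solutions of the first system into those of the second and transfers both facts.
-/

namespace ClusterDT

/-! ### Cartan matrices of finite type -/

/-- The positive definite symmetrization of a Cartan matrix of finite type, unpacked into sums. -/
theorem IsFiniteCartan.exists_symmetrizer {n : ℕ} {A : Matrix (Fin n) (Fin n) ℤ}
    (hA : IsFiniteCartan A) :
    ∃ d : Fin n → ℝ, (∀ i, 0 < d i) ∧ (∀ i j, d i * A i j = d j * A j i) ∧
      (∀ x : Fin n → ℝ, x ≠ 0 → 0 < ∑ i, x i * ∑ j, d i * A i j * x j) ∧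
      ∃ w : Fin n → ℝ, ∀ i, ∑ j, d i * A i j * w j = 1 := by
  obtain ⟨-, -, d, hd, hM⟩ := hA
  refine ⟨fun i => d i, fun i => Int.cast_pos.mpr (hd i), fun i j => ?_, fun x hx => ?_, ?_⟩
  · have h := congrFun (congrFun hM.isHermitian j) i
    simpa [Matrix.conjTranspose_apply, Matrix.diagonal_mul] using h
  · have h := hM.dotProduct_mulVec_pos hx
    simpa [dotProduct, Matrix.mulVec, Matrix.diagonal_mul] using h
  · have hU := (Matrix.isUnit_iff_isUnit_det _).mp hM.isUnit
    set M := (Matrix.diagonal d * A).map (Int.cast : ℤ → ℝ) with hMdef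
    refine ⟨M⁻¹.mulVec 1, fun i => ?_⟩
    have h : M.mulVec (M⁻¹.mulVec 1) = 1 := by
      rw [Matrix.mulVec_mulVec, Matrix.mul_nonsing_inv _ hU, Matrix.one_mulVec]
    have hi := congrFun h i
    rw [Matrix.mulVec, dotProduct] at hi
    simpa [hMdef, Matrix.diagonal_mul] using hi

/-- A Cartan matrix of finite type has a positive vector that its transpose maps to the all-ones
vector: the inverse of a positive definite matrix with nonpositive off-diagonal entries is
nonnegative. -/
theorem IsFiniteCartan.exists_pos_sum_eq_one {n : ℕ} {A : Matrix (Fin n) (Fin n) ℤ}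
    (hA : IsFiniteCartan A) :
    ∃ u : Fin n → ℝ, (∀ i, 0 < u i) ∧ ∀ i, ∑ j, (A j i : ℝ) * u j = 1 := by
  obtain ⟨d, hd, hsymm, hpos, w, hw⟩ := hA.exists_symmetrizer
  have hoff : ∀ i j, i ≠ j → d i * (A i j : ℝ) ≤ 0 := fun i j hij =>
    mul_nonpos_of_nonneg_of_nonpos (hd i).le (by exact_mod_cast hA.2.1 i j hij)
  -- the negative part of `w` has nonpositive norm
  have hneg : (fun i => max (-w i) 0) = 0 := by
    by_contra hne
    have h1 := hpos _ hne
    refine absurd h1 (not_lt.mpr (Finset.sum_nonpos fun i _ => ?_))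
    rcases le_total 0 (w i) with hi | hi
    · simp [max_eq_right (neg_nonpos.mpr hi)]
    · refine mul_nonpos_of_nonneg_of_nonpos (le_max_right _ _) ?_
      have h2 : ∑ j, d i * A i j * max (-w j) 0 ≤ ∑ j, -(d i * A i j * w j) := by
        refine Finset.sum_le_sum fun j _ => ?_
        by_cases hij : i = j
        · subst hij
          rw [max_eq_left (neg_nonneg.mpr hi)]
          exact le_of_eq (by ring)
        · have := mul_le_mul_of_nonpos_left (le_max_left (-w j) 0) (hoff i j hij)
          linarith
      rw [Finset.sum_neg_distrib, hw] at h2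
      linarith
  have hnn : ∀ i, 0 ≤ w i := fun i => by
    have := congrFun hneg i
    simp only [Pi.zero_apply] at this
    have h2 := le_max_left (-w i) 0
    linarith
  refine ⟨fun i => d i * w i, fun i => mul_pos (hd i) ?_, fun i => ?_⟩
  · refine lt_of_le_of_ne (hnn i) fun h0 => ?_
    have h1 : ∑ j, d i * A i j * w j ≤ 0 := by
      refine Finset.sum_nonpos fun j _ => ?_
      by_cases hij : i = j
      · subst hij; rw [← h0]; simp
      · exact mul_nonpos_of_nonpos_of_nonneg (hoff i j hij) (hnn j)
    rw [hw] at h1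
    linarith
  · rw [← hw i]
    refine Finset.sum_congr rfl fun j _ => ?_
    rw [hsymm i j]
    ring

/-! ### Acyclicity -/

theorem IsSkewSymmetrizable.pos_iff_neg {n : ℕ} {B : Matrix (Fin n) (Fin n) ℤ}
    (hB : IsSkewSymmetrizable B) (i j : Fin n) : 0 < B i j ↔ B j i < 0 := by
  obtain ⟨d, hd, h⟩ := hB
  have h1 := congrFun (congrFun h j) i
  simp only [Matrix.transpose_apply, Matrix.neg_apply, Matrix.diagonal_mul] at h1
  rw [← mul_pos_iff_of_pos_left (hd i), h1, neg_pos, ← neg_pos, ← mul_neg,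
    mul_pos_iff_of_pos_left (hd j), neg_pos]

/-- Orient the graph of `B` by `i → j` when `0 < B i j`. If every vertex of `S` had an outgoing edge
within `S`, then the subgraph on `S` would have at least as many edges as vertices; each of them
contributes at most `-2` and each vertex contributes `2` to the value of the normalized Cartan form
at the indicator function of `S`, which contradicts positivity. -/
theorem exists_forall_nonpos_of_isFiniteCartan {n : ℕ} {B : Matrix (Fin n) (Fin n) ℤ}
    (hB : IsSkewSymmetrizable B) (hA : IsFiniteCartan (cartanCompanion B)) (S : Finset (Fin n))
    (hS : S.Nonempty) : ∃ i ∈ S, ∀ j ∈ S, B i j ≤ 0 := by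
  by_contra! hcon
  choose! f hfS hf using hcon
  obtain ⟨d, hd, hsymm, hpos, -⟩ := hA.exists_symmetrizer
  have hdiag := hB.diag
  have hsign := hB.pos_iff_neg
  have hoff : ∀ i j, d i * |(B i j : ℝ)| = d j * |(B j i : ℝ)| := fun i j => by
    by_cases hij : i = j
    · rw [hij]
    · have := hsymm i j
      simp only [cartanCompanion, Matrix.of_apply, hij, Ne.symm hij, if_false] at this
      push_cast at this
      linarith
  set x : Fin n → ℝ := fun i => if i ∈ S then (√(d i))⁻¹ else 0 with hx
  have hxnn : ∀ i, 0 ≤ x i := fun i => by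
    simp only [hx]; split_ifs <;> positivity
  have hxS : ∀ i ∈ S, x i * x i * d i = 1 := fun i hi => by
    simp only [hx, hi, if_true]
    rw [← mul_inv, Real.mul_self_sqrt (hd i).le]
    exact inv_mul_cancel₀ (hd i).ne'
  have hx0 : ∀ i ∉ S, x i = 0 := fun i hi => by simp [hx, hi]
  have hxne : x ≠ 0 := by
    obtain ⟨i, hi⟩ := hS
    intro h
    have := hxS i hi
    rw [h] at this
    simp at this
  set s : Fin n → Fin n → ℝ := fun i j => x i * (d i * |(B i j : ℝ)|) * x j with hs
  have hsnn : ∀ i j, 0 ≤ s i j := fun i j =>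
    mul_nonneg (mul_nonneg (hxnn i) (mul_nonneg (hd i).le (abs_nonneg _))) (hxnn j)
  have hss : ∀ i j, s i j = s j i := fun i j => by
    simp only [hs]; rw [hoff i j]; ring
  have hs1 : ∀ i ∈ S, 1 ≤ s i (f i) := fun i hi => by
    have h1 := hf i hi
    have h2 := (hsign _ _).mp h1
    have e1 : (1 : ℝ) ≤ |(B i (f i) : ℝ)| := by
      exact_mod_cast Int.one_le_abs h1.ne'
    have e2 : (1 : ℝ) ≤ |(B (f i) i : ℝ)| := by
      exact_mod_cast Int.one_le_abs h2.ne
    have e3 : s i (f i) * s i (f i) = |(B i (f i) : ℝ)| * |(B (f i) i : ℝ)| := by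
      calc s i (f i) * s i (f i) = s i (f i) * s (f i) i := by rw [← hss]
        _ = (x i * x i * d i) * (x (f i) * x (f i) * d (f i)) *
            (|(B i (f i) : ℝ)| * |(B (f i) i : ℝ)|) := by simp only [hs]; ring
        _ = _ := by rw [hxS i hi, hxS _ (hfS i hi)]; ring
    nlinarith [hsnn i (f i)]
  have hq : ∑ i, x i * ∑ j, d i * (cartanCompanion B i j : ℝ) * x j =
      2 * S.card - ∑ i, ∑ j, s i j := by
    have h1 : ∀ i, x i * ∑ j, d i * (cartanCompanion B i j : ℝ) * x j =
        (if i ∈ S then 2 else 0) - ∑ j, s i j := fun i => by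
      have h2 : ∀ j, x i * (d i * (cartanCompanion B i j : ℝ) * x j) =
          (if i = j then 2 * (x i * x i * d i) else 0) - s i j := fun j => by
        by_cases hij : i = j
        · subst hij
          simp only [cartanCompanion, Matrix.of_apply, if_true, hs, hdiag]
          push_cast
          simp
          ring
        · simp only [cartanCompanion, Matrix.of_apply, hij, if_false, hs]
          push_cast
          ring
      rw [Finset.mul_sum, Finset.sum_congr rfl fun j _ => h2 j, Finset.sum_sub_distrib,
        Finset.sum_ite_eq]
      by_cases hi : i ∈ S
      · simp [hxS i hi, hi]
      · simp [hx0 i hi, hi]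
    rw [Finset.sum_congr rfl fun i _ => h1 i, Finset.sum_sub_distrib]
    simp [mul_comm]
  have hsplit : ∀ i j, s i j = (if 0 < B i j then s i j else 0) + (if 0 < B j i then s j i else 0) :=
    fun i j => by
      rcases lt_trichotomy (B i j) 0 with h | h | h
      · rw [if_neg h.not_gt, if_pos ((hsign j i).mpr h), hss i j, zero_add]
      · have h' : s i j = 0 := by simp [hs, h]
        simp [hss j i, h']
      · rw [if_pos h, if_neg ((hsign i j).mp h).not_gt, add_zero]
  have hge : (S.card : ℝ) ≤ ∑ i, ∑ j, if 0 < B i j then s i j else 0 := by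
    have hnn : ∀ i j, 0 ≤ if 0 < B i j then s i j else 0 := fun i j => by
      split_ifs
      exacts [hsnn i j, le_rfl]
    calc (S.card : ℝ) = ∑ i ∈ S, 1 := by simp
      _ ≤ ∑ i ∈ S, ∑ j, if 0 < B i j then s i j else 0 := by
        refine Finset.sum_le_sum fun i hi => (hs1 i hi).trans ?_
        refine le_trans (le_of_eq (if_pos (hf i hi)).symm)
          (Finset.single_le_sum (f := fun j => if 0 < B i j then s i j else 0)
            (fun j _ => hnn i j) (Finset.mem_univ (f i)))
      _ ≤ _ := Finset.sum_le_sum_of_subset_of_nonneg (Finset.subset_univ S)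
        fun i _ _ => Finset.sum_nonneg fun j _ => hnn i j
  have hsum : ∑ i, ∑ j, s i j = 2 * ∑ i, ∑ j, if 0 < B i j then s i j else 0 := by
    rw [Finset.sum_congr rfl fun i _ => Finset.sum_congr rfl fun j _ => hsplit i j]
    simp only [Finset.sum_add_distrib]
    rw [Finset.sum_comm (f := fun i j => if 0 < B j i then s j i else 0)]
    ring
  have := hpos x hxne
  rw [hq, hsum] at this
  linarith

/-- A skew-symmetrizable matrix whose Cartan companion is of finite type is, after a relabelling
that sorts the indices along the arrows, the matrix `B_A` of the relabelled companion. -/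
theorem exists_perm_cartanB {n : ℕ} {B : Matrix (Fin n) (Fin n) ℤ} (hB : IsSkewSymmetrizable B)
    (hA : IsFiniteCartan (cartanCompanion B)) :
    ∃ (π : Equiv.Perm (Fin n)) (A : Matrix (Fin n) (Fin n) ℤ), IsFiniteCartan A ∧
      ∀ i j, B (π i) (π j) = cartanB A i j := by
  have hsign := hB.pos_iff_neg
  have hwf : WellFounded fun i j => 0 < B j i := by
    rw [WellFounded.wellFounded_iff_has_min]
    intro S hS
    classical
    obtain ⟨i, hi, h⟩ := exists_forall_nonpos_of_isFiniteCartan hB hA S.toFinset (by simpa using hS)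
    exact ⟨i, by simpa using hi, fun j hj => not_lt.mpr (h j (by simpa using hj))⟩
  have : IsWellFounded (Fin n) fun i j => 0 < B j i := ⟨hwf⟩
  set r : Fin n → Ordinal := IsWellFounded.rank fun i j => 0 < B j i with hr
  set π := Tuple.sort r with hπ
  have hle : ∀ i j, i < j → B (π i) (π j) ≤ 0 := fun i j hij => by
    have h1 : r (π i) ≤ r (π j) := Tuple.monotone_sort r hij.le
    by_contra! h
    exact (IsWellFounded.rank_lt_of_rel (r := fun i j => 0 < B j i) h).not_ge h1
  refine ⟨π, (cartanCompanion B).submatrix π π, ⟨fun i => by simp [cartanCompanion], ?_, ?_⟩, ?_⟩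
  · intro i j hij
    simp [cartanCompanion, hij]
  · obtain ⟨-, -, d, hd, hM⟩ := hA
    refine ⟨d ∘ π, fun i => hd _, ?_⟩
    convert hM.submatrix π.injective using 1
    ext i j
    simp [Matrix.diagonal_mul]
  · intro i j
    rcases lt_trichotomy i j with h | h | h
    · simp [cartanB, cartanCompanion, h.ne, h.not_gt, abs_of_nonpos (hle i j h)]
    · subst h
      simp [cartanB, hB.diag]
    · have h1 : 0 ≤ B (π i) (π j) := by
        by_contra! h2
        exact (hle j i h).not_gt ((hsign _ _).mpr h2)
      simp [cartanB, cartanCompanion, h.ne', h, abs_of_nonneg h1]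

/-! ### The two systems of equations -/

theorem one_lt_of_mem_solA {n : ℕ} {A : Matrix (Fin n) (Fin n) ℤ} {a : Fin n → ℝ}
    (ha : a ∈ solA A) (i : Fin n) : 1 < a i ^ 2 := by
  rw [ha.2 i]
  have : 0 < ∏ j ∈ Finset.univ.erase i, a j ^ (-A j i) :=
    Finset.prod_pos fun j _ => zpow_pos (ha.1 j) _
  linarith

theorem sq_sub_one_mem_solX {n : ℕ} {A : Matrix (Fin n) (Fin n) ℤ} {a : Fin n → ℝ}
    (ha : a ∈ solA A) : (fun i => a i ^ 2 - 1) ∈ solX A := by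
  refine ⟨fun i => sub_pos.mpr (one_lt_of_mem_solA ha i), fun i => ?_⟩
  have h : a i ^ 2 - 1 = ∏ j ∈ Finset.univ.erase i, a j ^ (-A j i) := by
    rw [ha.2 i]; ring
  simp only [h]
  rw [← Finset.prod_pow]
  refine Finset.prod_congr rfl fun j _ => ?_
  rw [← zpow_natCast, zpow_comm, add_sub_cancel, zpow_natCast]

/-- In the logarithmic coordinates `log (1 + b_j)` the system reads
`Aᵀ log (1 + b) = 2 (log (1 + b) - log b)`; its left side comes from a positive definite form,
while each entry of its right side decreases in the corresponding coordinate. -/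
theorem solX_subsingleton {n : ℕ} {A : Matrix (Fin n) (Fin n) ℤ} (hA : IsFiniteCartan A) :
    (solX A).Subsingleton := by
  intro b hb c hc
  obtain ⟨d, hd, hsymm, hpos, -⟩ := hA.exists_symmetrizer
  have hlog : ∀ b ∈ solX A, ∀ i, ∑ j, (A j i : ℝ) * Real.log (1 + b j) =
      2 * (Real.log (1 + b i) - Real.log (b i)) := fun b hb i => by
    have h := congrArg Real.log (hb.2 i)
    rw [Real.log_pow, Real.log_prod fun j _ => (zpow_pos (by linarith [hb.1 j]) _).ne'] at h
    simp only [Real.log_zpow] at h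
    push_cast at h
    rw [← Finset.add_sum_erase _ _ (Finset.mem_univ i), hA.1 i]
    simp only [neg_mul, Finset.sum_neg_distrib] at h
    push_cast
    linarith
  set w : Fin n → ℝ := fun i => (Real.log (1 + b i) - Real.log (1 + c i)) / d i with hw
  have hw0 : w = 0 := by
    by_contra hne
    refine absurd (hpos w hne) (not_lt.mpr (Finset.sum_nonpos fun i _ => ?_))
    have h1 : ∑ j, d i * A i j * w j =
        2 * (Real.log (1 + b i) - Real.log (b i)) - 2 * (Real.log (1 + c i) - Real.log (c i)) := by
      rw [← hlog b hb i, ← hlog c hc i, ← Finset.sum_sub_distrib]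
      refine Finset.sum_congr rfl fun j _ => ?_
      have := (hd j).ne'
      rw [hsymm i j, hw]
      field_simp
    have hdiff : ∀ s t : ℝ, 0 < s → s ≤ t →
        Real.log (1 + t) - Real.log t ≤ Real.log (1 + s) - Real.log s := fun s t hs hst => by
      have ht := hs.trans_le hst
      rw [← Real.log_div (by positivity) ht.ne', ← Real.log_div (by positivity) hs.ne']
      refine Real.log_le_log (by positivity) ?_
      rw [div_le_div_iff₀ ht hs]
      linarith
    have hbi := hb.1 i
    have hci := hc.1 i
    rw [h1]
    rcases le_total (b i) (c i) with h | h
    · refine mul_nonpos_of_nonpos_of_nonneg (div_nonpos_of_nonpos_of_nonneg ?_ (hd i).le) ?_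
      · linarith [Real.log_le_log (by linarith) (by linarith : 1 + b i ≤ 1 + c i)]
      · linarith [hdiff _ _ hbi h]
    · refine mul_nonpos_of_nonneg_of_nonpos (div_nonneg ?_ (hd i).le) ?_
      · linarith [Real.log_le_log (by linarith) (by linarith : 1 + c i ≤ 1 + b i)]
      · linarith [hdiff _ _ hci h]
  funext i
  have h1 : Real.log (1 + b i) - Real.log (1 + c i) = 0 := by
    have := congrFun hw0 i
    simpa [hw, (hd i).ne'] using this
  have hbi := hb.1 i
  have hci := hc.1 i
  have := Real.log_injOn_pos (Set.mem_Ioi.mpr (by linarith)) (Set.mem_Ioi.mpr (by linarith))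
    (sub_eq_zero.mp h1)
  linarith

theorem solA_subsingleton {n : ℕ} {A : Matrix (Fin n) (Fin n) ℤ} (hA : IsFiniteCartan A) :
    (solA A).Subsingleton := by
  intro a ha c hc
  have h := solX_subsingleton hA (sq_sub_one_mem_solX ha) (sq_sub_one_mem_solX hc)
  funext i
  have hi := congrFun h i
  simp only [sub_left_inj] at hi
  exact (pow_left_inj₀ (ha.1 i).le (hc.1 i).le two_ne_zero).mp hi

/-- The map `a ↦ (1 + ∏_{j ≠ i} a_j ^ (-a_{j,i})) ^ (1/2)` is increasing, as the exponents are
nonnegative. It maps the box between `1` and `2 ^ u` to itself, where `Aᵀ u = (1, …, 1)`, so that it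
has a fixed point there by the Knaster–Tarski theorem. -/
theorem solA_nonempty {n : ℕ} {A : Matrix (Fin n) (Fin n) ℤ} (hA : IsFiniteCartan A) :
    (solA A).Nonempty := by
  obtain ⟨u, hu, hAu⟩ := hA.exists_pos_sum_eq_one
  have hexp : ∀ i, ∀ j ∈ Finset.univ.erase i, 0 ≤ -A j i := fun i j hj =>
    neg_nonneg.mpr (hA.2.1 j i (Finset.ne_of_mem_erase hj))
  have hmono : ∀ a b : Fin n → ℝ, 1 ≤ a → a ≤ b → ∀ i,
      ∏ j ∈ Finset.univ.erase i, a j ^ (-A j i) ≤ ∏ j ∈ Finset.univ.erase i, b j ^ (-A j i) :=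
    fun a b ha hab i => Finset.prod_le_prod
      (fun j _ => zpow_nonneg (zero_le_one.trans (ha j)) _)
      fun j hj => zpow_le_zpow_left₀ (hexp i j hj) (zero_le_one.trans (ha j)) (hab j)
  set c : Fin n → ℝ := fun i => 2 ^ u i with hc
  have h1c : (1 : Fin n → ℝ) ≤ c := fun i => Real.one_le_rpow one_le_two (hu i).le
  have hcsup : ∀ i, 1 + ∏ j ∈ Finset.univ.erase i, c j ^ (-A j i) ≤ c i ^ 2 := fun i => by
    have h1 := hAu i
    rw [← Finset.add_sum_erase _ _ (Finset.mem_univ i), hA.1 i] at h1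
    push_cast at h1
    have hnn : ∑ j ∈ Finset.univ.erase i, (A j i : ℝ) * u j ≤ 0 :=
      Finset.sum_nonpos fun j hj => mul_nonpos_of_nonpos_of_nonneg
        (by exact_mod_cast hA.2.1 j i (Finset.ne_of_mem_erase hj)) (hu j).le
    have h2 : ∏ j ∈ Finset.univ.erase i, c j ^ (-A j i) = 2 ^ (2 * u i - 1) := by
      have h3 : 2 * u i - 1 = ∑ j ∈ Finset.univ.erase i, u j * ((-A j i : ℤ) : ℝ) := by
        simp only [mul_comm (u _), Int.cast_neg, neg_mul, Finset.sum_neg_distrib]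
        linarith
      rw [h3, Real.rpow_sum_of_pos two_pos]
      exact Finset.prod_congr rfl fun j _ => by
        rw [Real.rpow_mul zero_le_two, Real.rpow_intCast]
    have h4 : c i ^ 2 = 2 * 2 ^ (2 * u i - 1) := by
      rw [hc, ← Real.rpow_natCast, ← Real.rpow_mul zero_le_two, Real.rpow_sub two_pos,
        Real.rpow_one, mul_comm (u i)]
      push_cast
      ring
    have h5 : (1 : ℝ) ≤ 2 ^ (2 * u i - 1) := Real.one_le_rpow one_le_two (by linarith)
    rw [h2, h4]
    linarith
  have : Fact ((1 : Fin n → ℝ) ≤ c) := ⟨h1c⟩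
  let F : Set.Icc (1 : Fin n → ℝ) c →o Set.Icc (1 : Fin n → ℝ) c :=
    { toFun := fun a => ⟨fun i => √(1 + ∏ j ∈ Finset.univ.erase i, a.1 j ^ (-A j i)),
        fun i => Real.one_le_sqrt.mpr (le_add_of_nonneg_right
          (Finset.prod_nonneg fun j _ => zpow_nonneg (zero_le_one.trans (a.2.1 j)) _)),
        fun i => Real.sqrt_le_iff.mpr ⟨zero_le_one.trans (h1c i),
          (add_le_add_right (hmono _ _ a.2.1 a.2.2 i) 1).trans (hcsup i)⟩⟩
      monotone' := fun a b hab i =>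
        Real.sqrt_le_sqrt (add_le_add_right (hmono _ _ a.2.1 hab i) 1) }
  have hfix : F F.lfp = F.lfp := F.map_lfp
  have hpos : ∀ i, 0 < F.lfp.1 i := fun i => zero_lt_one.trans_le (F.lfp.2.1 i)
  refine ⟨F.lfp.1, hpos, fun i => ?_⟩
  have h := congrFun (congrArg Subtype.val hfix) i
  have h' : √(1 + ∏ j ∈ Finset.univ.erase i, F.lfp.1 j ^ (-A j i)) = F.lfp.1 i := h
  rw [← h', Real.sq_sqrt (add_nonneg zero_le_one
    (Finset.prod_nonneg fun j _ => zpow_nonneg (hpos j).le _))]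

/-! ### Points from clusters -/

theorem gen_mul_gen {n : ℕ} (k : Fin n) : gen k * gen k = 1 := by
  rw [gen, ← map_mul]
  exact map_one _

/-- The homomorphism from `ℤ/2` given by an involution. -/
def involutionHom {G : Type*} [Group G] (s : G) (hs : s * s = 1) : Multiplicative (ZMod 2) →* G where
  toFun m := if m = 1 then 1 else s
  map_one' := if_pos rfl
  map_mul' := by
    have h : ∀ m : Multiplicative (ZMod 2), m = 1 ∨ m = Multiplicative.ofAdd 1 := by decide
    intro a b
    rcases h a with rfl | rfl <;> rcases h b with rfl | rfl
    · simp
    · simp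
    · simp
    · rw [if_pos (by decide), if_neg (by decide), hs]

/-- Positive values prescribed at one vertex extend to the whole tree along mutation rules that are
inverse to each other on the two sides of every edge: such rules define an action of the free
product of copies of `ℤ/2` on pairs of a vertex and a positive vector. -/
theorem exists_extension {n : ℕ} (F : Tree n → Fin n → (Fin n → ℝ) → Fin n → ℝ)
    (hpos : ∀ t k x, (∀ i, 0 < x i) → ∀ i, 0 < F t k x i)
    (hinv : ∀ t k x, (∀ i, 0 < x i) → F (t * gen k) k (F t k x) = x)
    (t₀ : Tree n) (x₀ : Fin n → ℝ) (h₀ : ∀ i, 0 < x₀ i) :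
    ∃ f : Tree n → Fin n → ℝ, f t₀ = x₀ ∧ (∀ t i, 0 < f t i) ∧
      ∀ t k, f (t * gen k) = F t k (f t) := by
  let step : Fin n → Tree n × {x : Fin n → ℝ // ∀ i, 0 < x i} →
      Tree n × {x : Fin n → ℝ // ∀ i, 0 < x i} :=
    fun k s => (s.1 * gen k, ⟨F s.1 k s.2, hpos _ _ _ s.2.2⟩)
  have hstep : ∀ k, Function.Involutive (step k) := fun k s => by
    refine Prod.ext ?_ (Subtype.ext ?_)
    · simp [step, mul_assoc, gen_mul_gen]
    · exact hinv _ _ _ s.2.2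
  let Φ : Tree n →* Equiv.Perm (Tree n × {x : Fin n → ℝ // ∀ i, 0 < x i}) :=
    Monoid.CoprodI.lift fun k => involutionHom (hstep k).toPerm
      (Equiv.ext fun s => hstep k s)
  have hgen : ∀ k s, Φ (gen k) s = step k s := fun k s => by
    simp only [Φ, gen, Monoid.CoprodI.lift_of]
    rfl
  have hs : ∀ t k, Φ ((t₀⁻¹ * (t * gen k))⁻¹) (t₀, ⟨x₀, h₀⟩) =
      step k (Φ ((t₀⁻¹ * t)⁻¹) (t₀, ⟨x₀, h₀⟩)) := fun t k => by
    rw [← mul_assoc, mul_inv_rev, inv_eq_of_mul_eq_one_left (gen_mul_gen k), map_mul,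
      Equiv.Perm.mul_apply, hgen]
  have h1 : ∀ t, (Φ ((t₀⁻¹ * t)⁻¹) (t₀, ⟨x₀, h₀⟩)).1 = t := fun t => by
    induction t using tree_induction t₀ with
    | h0 => simp
    | hs t k ih =>
      rw [hs]
      exact congrArg (· * gen k) ih
  refine ⟨fun t => (Φ ((t₀⁻¹ * t)⁻¹) (t₀, ⟨x₀, h₀⟩)).2.1, by simp,
    fun t => (Φ ((t₀⁻¹ * t)⁻¹) (t₀, ⟨x₀, h₀⟩)).2.2, fun t k => ?_⟩
  simp only [hs, step, h1]

theorem matMutate_apply_col {n : ℕ} (B : Matrix (Fin n) (Fin n) ℤ) (j k : Fin n) :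
    matMutate id k B j k = -B j k := by
  simp [matMutate]

theorem matMutate_apply_row {n : ℕ} (B : Matrix (Fin n) (Fin n) ℤ) (k j : Fin n) :
    matMutate id k B k j = -B k j := by
  simp [matMutate]

theorem mutA_pos {n : ℕ} (B : Matrix (Fin n) (Fin n) ℤ) (k : Fin n) {x : Fin n → ℝ}
    (hx : ∀ i, 0 < x i) (i : Fin n) : 0 < mutA B k x i := by
  rw [mutA]
  split_ifs
  · exact mul_pos (inv_pos.mpr (hx k)) (add_pos (Finset.prod_pos fun j _ => zpow_pos (hx j) _)
      (Finset.prod_pos fun j _ => zpow_pos (hx j) _))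
  · exact hx i

theorem mutX_pos {n : ℕ} (B : Matrix (Fin n) (Fin n) ℤ) (k : Fin n) {y : Fin n → ℝ}
    (hy : ∀ i, 0 < y i) (i : Fin n) : 0 < mutX B k y i := by
  rw [mutX]
  have := hy k
  have := hy i
  split_ifs <;> positivity

theorem mutA_mutA {n : ℕ} {B : Matrix (Fin n) (Fin n) ℤ} {k : Fin n} (hk : B k k = 0)
    {x : Fin n → ℝ} (hx : ∀ i, 0 < x i) : mutA (matMutate id k B) k (mutA B k x) = x := by
  have h : ∀ e : Fin n → ℤ, e k = 0 → ∏ j, mutA B k x j ^ e j = ∏ j, x j ^ e j := fun e he =>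
    Finset.prod_congr rfl fun j _ => by
      by_cases hj : j = k
      · rw [hj, he, zpow_zero, zpow_zero]
      · simp [mutA, hj]
  funext i
  by_cases hi : i = k
  · subst hi
    rw [mutA, if_pos rfl]
    simp only [matMutate_apply_col]
    rw [h _ (by simp [hk]), h _ (by simp [hk])]
    simp only [mutA, if_true, neg_neg]
    have h1 : 0 < ∏ j, x j ^ max (B j i) 0 := Finset.prod_pos fun j _ => zpow_pos (hx j) _
    have h2 : 0 < ∏ j, x j ^ max (-B j i) 0 := Finset.prod_pos fun j _ => zpow_pos (hx j) _
    have h3 := (hx i).ne'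
    rw [mul_inv, inv_inv, mul_assoc, add_comm (∏ j, x j ^ max (-B j i) 0),
      inv_mul_cancel₀ (add_pos h1 h2).ne', mul_one]
  · simp [mutA, hi]

theorem mutX_mutX {n : ℕ} (B : Matrix (Fin n) (Fin n) ℤ) (k : Fin n)
    {y : Fin n → ℝ} (hy : ∀ i, 0 < y i) : mutX (matMutate id k B) k (mutX B k y) = y := by
  funext i
  by_cases hi : i = k
  · simp [mutX, hi]
  · have hk := hy k
    have h1 : 1 + (y k)⁻¹ = (1 + y k) * (y k)⁻¹ := by field_simp; ring
    simp only [mutX, hi, if_false, if_true, matMutate_apply_row, neg_neg]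
    rw [h1, mul_zpow, inv_zpow', inv_zpow']
    calc _ = y i * (y k ^ max (B k i) 0 * y k ^ (-max (-B k i) 0) * y k ^ (-B k i)) *
          ((1 + y k) ^ (-B k i) * (1 + y k) ^ B k i) := by ring
      _ = y i := by
        rw [← zpow_add₀ hk.ne', ← zpow_add₀ hk.ne', ← zpow_add₀ (by positivity)]
        have e1 : max (B k i) 0 + -max (-B k i) 0 + -B k i = 0 := by omega
        rw [e1, neg_add_cancel, zpow_zero, zpow_zero, mul_one, mul_one]

namespace ClusterEnsemble

variable {n : ℕ} {E : ClusterEnsemble n}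

theorem APos.ext_cluster {a a' : E.APos} (t₀ : Tree n) (h : a.x t₀ = a'.x t₀) : a = a' := by
  refine APos.ext (funext fun t => ?_)
  induction t using tree_induction t₀ with
  | h0 => exact h
  | hs t k ih => rw [a.mutation, a'.mutation, ih]

theorem XPos.ext_cluster {b b' : E.XPos} (t₀ : Tree n) (h : b.y t₀ = b'.y t₀) : b = b' := by
  refine XPos.ext (funext fun t => ?_)
  induction t using tree_induction t₀ with
  | h0 => exact h
  | hs t k ih => rw [b.mutation, b'.mutation, ih]

variable (E)

theorem exists_aPos (t₀ : Tree n) (x₀ : Fin n → ℝ) (h₀ : ∀ i, 0 < x₀ i) :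
    ∃ a : E.APos, a.x t₀ = x₀ := by
  obtain ⟨f, hf, hpos, hmut⟩ := exists_extension (fun t k x => mutA (E.B t) k x)
    (fun t k x hx => mutA_pos _ _ hx)
    (fun t k x hx => by rw [E.mutation]; exact mutA_mutA ((E.skew t).diag k) hx) t₀ x₀ h₀
  exact ⟨⟨f, hpos, hmut⟩, hf⟩

theorem exists_xPos (t₀ : Tree n) (y₀ : Fin n → ℝ) (h₀ : ∀ i, 0 < y₀ i) :
    ∃ b : E.XPos, b.y t₀ = y₀ := by
  obtain ⟨f, hf, hpos, hmut⟩ := exists_extension (fun t k y => mutX (E.B t) k y)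
    (fun t k y hy => mutX_pos _ _ hy)
    (fun t k y hy => by rw [E.mutation]; exact mutX_mutX _ _ hy) t₀ y₀ h₀
  exact ⟨⟨f, hpos, hmut⟩, hf⟩

variable {E}

theorem DTA_eq_self_iff {t₀ t₁ : Tree n} (h : E.IsReddeningTriple t₀ t₁ 1) (a : E.APos) :
    DTA h a = a ↔ a.x t₁ = a.x t₀ := by
  have h1 : (DTA h a).x t₀ = a.x t₁ := by
    funext i
    simp [DTA, shift_self]
  exact ⟨fun hf => by rw [← h1, hf], fun hf => APos.ext_cluster t₀ (h1.trans hf)⟩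

theorem DTX_eq_self_iff {t₀ t₁ : Tree n} (h : E.IsReddeningTriple t₀ t₁ 1) (b : E.XPos) :
    DTX h b = b ↔ b.y t₁ = b.y t₀ := by
  have h1 : (DTX h b).y t₀ = b.y t₁ := by
    funext i
    simp [DTX, shift_self]
  exact ⟨fun hf => by rw [← h1, hf], fun hf => XPos.ext_cluster t₀ (h1.trans hf)⟩

/-- The ensemble map intertwines the two DT transformations. -/
theorem p_DTA {t₀ t₁ : Tree n} {σ : Equiv.Perm (Fin n)} (h : E.IsReddeningTriple t₀ t₁ σ)
    (a : E.APos) : E.p (DTA h a) = DTX h (E.p a) := by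
  refine XPos.ext (funext fun t => funext fun j => ?_)
  change ∏ i, a.x (shift t₀ t₁ σ t) (σ i) ^ E.B t i j =
    ∏ i, a.x (shift t₀ t₁ σ t) i ^ E.B (shift t₀ t₁ σ t) i (σ j)
  rw [← Equiv.prod_comp σ fun i => a.x (shift t₀ t₁ σ t) i ^ E.B (shift t₀ t₁ σ t) i (σ j)]
  exact Finset.prod_congr rfl fun i _ => by rw [h.B_shift t]

end ClusterEnsemble

/-! ### Mutation along the path from `t₀` to `t₀[1]` -/

theorem foldl_ofFn_induction {n : ℕ} {α β : Type*} (f : β → α → β) (g : Fin n → α) (b : β)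
    (P : ℕ → β → Prop) (h0 : P 0 b) (hs : ∀ (m : Fin n) s, P m s → P (m + 1) (f s (g m))) :
    P n ((List.ofFn g).foldl f b) := by
  induction n with
  | zero => simpa using h0
  | succ n ih =>
    rw [List.ofFn_succ_last, List.foldl_append]
    exact hs (Fin.last n) _ (ih _ fun m s => hs m.castSucc s)

theorem mul_word {n : ℕ} (t : Tree n) (w : List (Fin n)) :
    t * word w = w.foldl (fun s k => s * gen k) t := by
  induction w generalizing t with
  | nil => simp [word]
  | cons k w ih =>
    rw [List.foldl_cons, ← ih, word, word, List.map_cons, List.prod_cons, mul_assoc]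

/-- The sign `-1` on the first `m` indices and `1` on the others: after `m` mutations along the path
the matrix entries of a Cartan seed have changed by the product of the signs of their indices. -/
def flipSign {n : ℕ} (m : ℕ) (i : Fin n) : ℤ := if (i : ℕ) < m then -1 else 1

theorem flipSign_succ {n : ℕ} (k i : Fin n) :
    flipSign (k + 1) i = if i = k then -flipSign k i else flipSign k i := by
  simp only [flipSign, Fin.ext_iff]
  grind

theorem flipSign_mul_cartanB_col {n : ℕ} (A : Matrix (Fin n) (Fin n) ℤ) (i k : Fin n) :
    flipSign k i * flipSign k k * cartanB A i k = if i = k then 0 else -A i k := by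
  simp only [flipSign, cartanB, Matrix.of_apply, Fin.lt_def, Fin.ext_iff]
  grind

theorem flipSign_mul_cartanB_row {n : ℕ} (A : Matrix (Fin n) (Fin n) ℤ) (k j : Fin n) :
    flipSign k k * flipSign k j * cartanB A k j = if j = k then 0 else A k j := by
  simp only [flipSign, cartanB, Matrix.of_apply, Fin.lt_def, Fin.ext_iff]
  grind

/-- The principal rows of `M`, relabelled by `π`, are those of `B_A` after `m` mutations. -/
def IsFlipped {n : ℕ} {ι : Type} (e : Fin n → ι) (π : Equiv.Perm (Fin n))
    (A : Matrix (Fin n) (Fin n) ℤ) (m : ℕ) (M : Matrix ι (Fin n) ℤ) : Prop :=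
  ∀ i j, M (e (π i)) (π j) = flipSign m i * flipSign m j * cartanB A i j

/-- Mutation at a vertex with nonnegative column and nonpositive row only changes signs. -/
theorem matMutate_apply_of_sign {n : ℕ} {ι : Type} [DecidableEq ι] {e : Fin n → ι} {k : Fin n}
    {M : Matrix ι (Fin n) ℤ} (hcol : ∀ i, 0 ≤ M i k) (hrow : ∀ j, M (e k) j ≤ 0) (i : ι)
    (j : Fin n) : matMutate e k M i j = if i = e k ∨ j = k then -M i j else M i j := by
  simp only [matMutate, Matrix.of_apply, max_eq_right (hrow j),
    max_eq_right (neg_nonpos.mpr (hcol i)), mul_zero, zero_mul, add_zero, sub_zero]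

namespace IsFlipped

variable {n : ℕ} {ι : Type} {e : Fin n → ι} {π : Equiv.Perm (Fin n)}
  {A : Matrix (Fin n) (Fin n) ℤ} {k : Fin n} {M : Matrix ι (Fin n) ℤ}

theorem col (h : IsFlipped e π A k M) (i : Fin n) :
    M (e (π i)) (π k) = if i = k then 0 else -A i k := by
  rw [h, flipSign_mul_cartanB_col]

theorem row (h : IsFlipped e π A k M) (j : Fin n) :
    M (e (π k)) (π j) = if j = k then 0 else A k j := by
  rw [h, flipSign_mul_cartanB_row]

theorem col_nonneg (h : IsFlipped e π A k M) (hA : IsFiniteCartan A) (i : Fin n) :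
    0 ≤ M (e i) (π k) := by
  have h1 := h.col (π.symm i)
  rw [π.apply_symm_apply] at h1
  rw [h1]
  split_ifs with h2
  exacts [le_rfl, neg_nonneg.mpr (hA.2.1 _ _ h2)]

theorem row_nonpos (h : IsFlipped e π A k M) (hA : IsFiniteCartan A) (j : Fin n) :
    M (e (π k)) j ≤ 0 := by
  have h1 := h.row (π.symm j)
  rw [π.apply_symm_apply] at h1
  rw [h1]
  split_ifs with h2
  exacts [le_rfl, hA.2.1 _ _ (Ne.symm h2)]

theorem matMutate [DecidableEq ι] (h : IsFlipped e π A k M) (hA : IsFiniteCartan A)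
    (he : Function.Injective e) (hcol : ∀ i, 0 ≤ M i (π k)) :
    IsFlipped e π A (k + 1) (matMutate e (π k) M) := by
  intro i j
  rw [matMutate_apply_of_sign hcol (h.row_nonpos hA), h i j, flipSign_succ, flipSign_succ]
  simp only [he.eq_iff, EmbeddingLike.apply_eq_iff_eq]
  by_cases hi : i = k <;> by_cases hj : j = k
  · subst hi hj
    simp [cartanB]
  · simp [hi, hj]
  · simp [hi, hj]
  · simp [hi, hj]

theorem mutA_apply {B : Matrix (Fin n) (Fin n) ℤ}
    (hB : IsFlipped id π A k B) (hA : IsFiniteCartan A) (x : Fin n → ℝ) :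
    mutA B (π k) x (π k) =
      (x (π k))⁻¹ * (1 + ∏ j ∈ Finset.univ.erase k, x (π j) ^ (-A j k)) := by
  have hcol : ∀ i, B (π i) (π k) = if i = k then 0 else -A i k := hB.col
  have h1 : ∏ j, x j ^ max (B j (π k)) 0 = ∏ j ∈ Finset.univ.erase k, x (π j) ^ (-A j k) := by
    rw [← Equiv.prod_comp π, ← Finset.mul_prod_erase _ _ (Finset.mem_univ k), hcol]
    simp only [if_true, max_self, zpow_zero, one_mul]
    refine Finset.prod_congr rfl fun j hj => ?_
    have hjk := Finset.ne_of_mem_erase hj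
    rw [hcol, if_neg hjk, max_eq_left (neg_nonneg.mpr (hA.2.1 _ _ hjk))]
  have h2 : ∏ j, x j ^ max (-B j (π k)) 0 = 1 := Finset.prod_eq_one fun j _ => by
    have h3 : 0 ≤ B j (π k) := hB.col_nonneg hA j
    rw [max_eq_right (neg_nonpos.mpr h3), zpow_zero]
  rw [mutA, if_pos rfl, h1, h2, add_comm]

theorem mutX_apply {B : Matrix (Fin n) (Fin n) ℤ} {i : Fin n}
    (hB : IsFlipped id π A k B) (hA : IsFiniteCartan A) (hi : i ≠ k) (y : Fin n → ℝ) :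
    mutX B (π k) y (π i) = y (π i) * (1 + y (π k)) ^ (-A k i) := by
  have hrow : ∀ j, B (π k) (π j) = if j = k then 0 else A k j := hB.row
  rw [mutX, if_neg (by simpa using hi), hrow, if_neg hi, max_eq_right (hA.2.1 _ _ hi.symm),
    zpow_zero, mul_one]

end IsFlipped

namespace ClusterEnsemble

variable {n : ℕ} {E : ClusterEnsemble n} {t₀ : Tree n} {π : Equiv.Perm (Fin n)}
  {A : Matrix (Fin n) (Fin n) ℤ}

theorem IsCartanSeed.isFlipped_zero (h : E.IsCartanSeed t₀ π A) :
    IsFlipped id π A 0 (E.B t₀) := fun i j => by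
  simp [flipSign, h.2]

/-- Every mutation of the path is at a vertex whose column in the extended matrix is nonnegative and
whose row in the principal part is nonpositive, so that it only changes signs. Each entry of the
principal part changes its sign twice, each entry of the coefficient part once. -/
theorem IsCartanSeed.isReddeningTriple (h : E.IsCartanSeed t₀ π A) :
    E.IsReddeningTriple t₀ (t₀ * word (List.ofFn π)) 1 := by
  refine ⟨List.ofFn π, rfl, ?_⟩
  have key := foldl_ofFn_induction (fun N k => ClusterDT.matMutate Sum.inl k N) π
    (Matrix.fromRows (E.B t₀) (1 : Matrix (Fin n) (Fin n) ℤ))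
    (fun m M => IsFlipped Sum.inl π A m M ∧
      ∀ i j, M (Sum.inr i) (π j) = flipSign m j * (1 : Matrix (Fin n) (Fin n) ℤ) i (π j))
    ⟨fun i j => by simpa using h.isFlipped_zero i j, fun i j => by simp [flipSign]⟩
    (by
      rintro k M ⟨h1, h2⟩
      have hcol : ∀ i, 0 ≤ M i (π k) := by
        rintro (i | i)
        · exact h1.col_nonneg h.1 i
        · rw [h2, Matrix.one_apply]
          simp only [flipSign, lt_irrefl, if_false]
          split_ifs <;> norm_num
      refine ⟨h1.matMutate h.1 Sum.inl_injective hcol, fun i j => ?_⟩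
      rw [matMutate_apply_of_sign hcol (h1.row_nonpos h.1), h2, flipSign_succ]
      simp only [reduceCtorEq, false_or, EmbeddingLike.apply_eq_iff_eq]
      split_ifs <;> ring)
  obtain ⟨h1, h2⟩ := key
  have hs : ∀ i : Fin n, flipSign n i = -1 := fun i => by simp [flipSign]
  rw [matMutateList]
  have hbar : sigmaBar (1 : Equiv.Perm (Fin n)) = 1 := by
    ext i j
    simp only [sigmaBar, Matrix.of_apply, Matrix.one_apply, Equiv.Perm.one_apply]
    congr
  rw [inv_one, hbar, one_mul, mul_one]
  ext i j
  obtain ⟨j, rfl⟩ := π.surjective j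
  rcases i with i | i
  · obtain ⟨i, rfl⟩ := π.surjective i
    rw [h1, hs, hs, Matrix.fromRows_apply_inl, h.2]
    ring
  · rw [h2, hs, Matrix.fromRows_apply_inr, Matrix.neg_apply, neg_one_mul]

/-- The exchange relations along the path. -/
theorem IsCartanSeed.x_word_mul (h : E.IsCartanSeed t₀ π A) (a : E.APos) (i : Fin n) :
    a.x (t₀ * word (List.ofFn π)) (π i) * a.x t₀ (π i) =
      1 + ∏ j ∈ Finset.univ.erase i,
        (if j < i then a.x (t₀ * word (List.ofFn π)) (π j) else a.x t₀ (π j)) ^ (-A j i) := by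
  have key := foldl_ofFn_induction (fun s k => s * gen k) π t₀
    (fun m t => IsFlipped id π A m (E.B t) ∧
      (∀ i : Fin n, m ≤ i → a.x t (π i) = a.x t₀ (π i)) ∧
      ∀ i : Fin n, (i : ℕ) < m → a.x t (π i) * a.x t₀ (π i) =
        1 + ∏ j ∈ Finset.univ.erase i, (if j < i then a.x t (π j) else a.x t₀ (π j)) ^ (-A j i))
    ⟨h.isFlipped_zero, fun _ _ => rfl, fun i hi => absurd hi (Nat.not_lt_zero _)⟩
    (by
      rintro k t ⟨h1, h2, h3⟩
      have hne : ∀ i : Fin n, i ≠ k → a.x (t * gen (π k)) (π i) = a.x t (π i) := fun i hi => by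
        rw [a.mutation, mutA, if_neg (by simpa using hi)]
      refine ⟨?_, fun i hi => ?_, fun i hi => ?_⟩
      · rw [E.mutation]
        exact h1.matMutate h.1 Function.injective_id fun i => h1.col_nonneg h.1 i
      · rw [hne i (fun hik => by subst hik; omega), h2 i (by omega)]
      · have hlt : ∀ j, j < i → a.x (t * gen (π k)) (π j) = a.x t (π j) := fun j hj =>
          hne j (fun hjk => by subst hjk; rw [Fin.lt_def] at hj; omega)
        have hprod : ∏ j ∈ Finset.univ.erase i,
            (if j < i then a.x (t * gen (π k)) (π j) else a.x t₀ (π j)) ^ (-A j i) =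
            ∏ j ∈ Finset.univ.erase i,
              (if j < i then a.x t (π j) else a.x t₀ (π j)) ^ (-A j i) :=
          Finset.prod_congr rfl fun j _ => by
            split_ifs with hj
            · rw [hlt j hj]
            · rfl
        rw [hprod]
        by_cases hik : i = k
        · subst hik
          rw [a.mutation, h1.mutA_apply h.1, ← h2 i le_rfl, mul_comm (_⁻¹), mul_assoc,
            inv_mul_cancel₀ (a.pos _ _).ne', mul_one]
          congr 1
          refine Finset.prod_congr rfl fun j _ => ?_
          split_ifs with hj
          · rfl
          · rw [h2 j (by rw [Fin.lt_def] at hj; omega)]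
        · rw [hne i hik, h3 i (by rw [Fin.ext_iff] at hik; omega)])
  rw [← mul_word] at key
  exact key.2.2 i i.2

theorem IsCartanSeed.x_word_eq_iff (h : E.IsCartanSeed t₀ π A) (a : E.APos) :
    a.x (t₀ * word (List.ofFn π)) = a.x t₀ ↔ (fun i => a.x t₀ (π i)) ∈ solA A := by
  have hx := h.x_word_mul a
  constructor
  · intro hf
    refine ⟨fun i => a.pos _ _, fun i => ?_⟩
    have h1 := hx i
    simp only [hf, ite_self] at h1
    rw [← h1, sq]
  · rintro ⟨-, hs⟩
    have hi : ∀ i : Fin n, a.x (t₀ * word (List.ofFn π)) (π i) = a.x t₀ (π i) := fun i => by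
      induction i using WellFoundedLT.induction with
      | ind i ih =>
        refine mul_right_cancel₀ (a.pos t₀ (π i)).ne' ?_
        rw [hx i, ← sq, hs i]
        congr 1
        refine Finset.prod_congr rfl fun j _ => ?_
        split_ifs with hj
        · rw [ih j hj]
        · rfl
    funext i
    simpa using hi (π.symm i)

end ClusterEnsemble

/-! ### The coordinates `Y` -/

theorem bigY_eq {n : ℕ} (A : Matrix (Fin n) (Fin n) ℤ) (y : Fin n → ℝ) (i : Fin n) :
    bigY A y i = y i * ∏ j with j < i, (1 + bigY A y j) ^ (-A j i) := by
  rw [bigY]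
  congr 1
  exact (Finset.prod_subtype (Finset.univ.filter (· < i)) (by simp)
    fun j => (1 + bigY A y j) ^ (-A j i)).symm

theorem bigY_pos {n : ℕ} (A : Matrix (Fin n) (Fin n) ℤ) {y : Fin n → ℝ} (hy : ∀ i, 0 < y i)
    (i : Fin n) : 0 < bigY A y i := by
  induction i using WellFoundedLT.induction with
  | ind i ih =>
    rw [bigY_eq]
    refine mul_pos (hy i) (Finset.prod_pos fun j hj => zpow_pos ?_ _)
    have := ih j (by simpa using hj)
    linarith

theorem prod_one_add_pos {n : ℕ} {Y : Fin n → ℝ} (hY : ∀ i, 0 < Y i) (e : Fin n → ℤ)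
    (s : Finset (Fin n)) : 0 < ∏ j ∈ s, (1 + Y j) ^ e j :=
  Finset.prod_pos fun j _ => zpow_pos (by linarith [hY j]) _

theorem exists_bigY_eq {n : ℕ} (A : Matrix (Fin n) (Fin n) ℤ) {Y : Fin n → ℝ}
    (hY : ∀ i, 0 < Y i) : ∃ y : Fin n → ℝ, (∀ i, 0 < y i) ∧ bigY A y = Y := by
  refine ⟨fun i => Y i / ∏ j with j < i, (1 + Y j) ^ (-A j i),
    fun i => div_pos (hY i) (prod_one_add_pos hY _ _), funext fun i => ?_⟩
  induction i using WellFoundedLT.induction with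
  | ind i ih =>
    have hprod : ∏ j with j < i, (1 + bigY A (fun i => Y i /
        ∏ j with j < i, (1 + Y j) ^ (-A j i)) j) ^ (-A j i) =
        ∏ j with j < i, (1 + Y j) ^ (-A j i) :=
      Finset.prod_congr rfl fun j hj => by rw [ih j (by simpa using hj)]
    rw [bigY_eq, hprod]
    exact div_mul_cancel₀ _ (prod_one_add_pos hY _ _).ne'

theorem bigY_injOn {n : ℕ} (A : Matrix (Fin n) (Fin n) ℤ) :
    Set.InjOn (bigY A) {y | ∀ i, 0 < y i} := by
  intro y hy y' _ h
  funext i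
  have hi := congrFun h i
  rw [bigY_eq, bigY_eq A y', h] at hi
  exact mul_right_cancel₀ (prod_one_add_pos (h ▸ bigY_pos A hy) _ _).ne' hi

namespace ClusterEnsemble

variable {n : ℕ} {E : ClusterEnsemble n} {t₀ : Tree n} {π : Equiv.Perm (Fin n)}
  {A : Matrix (Fin n) (Fin n) ℤ}

/-- The coordinate `Y_i` is the value of the `y`-variable at which the `i`-th mutation of the path
takes place. -/
theorem IsCartanSeed.y_word (h : E.IsCartanSeed t₀ π A) (b : E.XPos) (i : Fin n) :
    b.y (t₀ * word (List.ofFn π)) (π i) = (bigY A (fun i => b.y t₀ (π i)) i)⁻¹ *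
      ∏ j with i < j, (1 + bigY A (fun i => b.y t₀ (π i)) j) ^ (-A j i) := by
  set Y := bigY A (fun i => b.y t₀ (π i)) with hY
  have key := foldl_ofFn_induction (fun s k => s * gen k) π t₀
    (fun m t => IsFlipped id π A m (E.B t) ∧
      (∀ i : Fin n, m ≤ i → b.y t (π i) =
        b.y t₀ (π i) * ∏ j : Fin n with j.val < m, (1 + Y j) ^ (-A j i)) ∧
      ∀ i : Fin n, (i : ℕ) < m → b.y t (π i) =
        (Y i)⁻¹ * ∏ j : Fin n with i < j ∧ j.val < m, (1 + Y j) ^ (-A j i))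
    ⟨h.isFlipped_zero, fun i _ => by simp, fun i hi => absurd hi (Nat.not_lt_zero _)⟩
    (by
      rintro k t ⟨h1, h2, h3⟩
      have hk : b.y t (π k) = Y k := by
        rw [h2 k le_rfl, hY, bigY_eq]
        rfl
      have hne : ∀ i : Fin n, i ≠ k →
          b.y (t * gen (π k)) (π i) = b.y t (π i) * (1 + Y k) ^ (-A k i) := fun i hi => by
        rw [b.mutation, h1.mutX_apply h.1 hi, hk]
      refine ⟨?_, fun i hi => ?_, fun i hi => ?_⟩
      · rw [E.mutation]
        exact h1.matMutate h.1 Function.injective_id fun i => h1.col_nonneg h.1 i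
      · have hs : Finset.univ.filter (fun j : Fin n => j.val < k.val + 1) =
            insert k (Finset.univ.filter fun j : Fin n => j.val < k.val) := by
          ext j
          simp only [Finset.mem_filter, Finset.mem_univ, true_and, Finset.mem_insert, Fin.ext_iff]
          omega
        rw [hne i (fun hik => by subst hik; omega), h2 i (by omega), hs,
          Finset.prod_insert (by simp)]
        ring
      · by_cases hik : i = k
        · subst hik
          have hs : Finset.univ.filter (fun j : Fin n => i < j ∧ j.val < i.val + 1) = ∅ := by
            ext j
            simp only [Finset.mem_filter, Finset.mem_univ, true_and, Finset.notMem_empty, iff_false,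
              Fin.lt_def]
            omega
          rw [hs, Finset.prod_empty, mul_one, b.mutation, mutX, if_pos rfl, hk]
        · have hik' : i.val < k.val := by rw [Fin.ext_iff] at hik; omega
          have hs : Finset.univ.filter (fun j : Fin n => i < j ∧ j.val < k.val + 1) =
              insert k (Finset.univ.filter fun j : Fin n => i < j ∧ j.val < k.val) := by
            ext j
            simp only [Finset.mem_filter, Finset.mem_univ, true_and, Finset.mem_insert,
              Fin.ext_iff, Fin.lt_def]
            omega
          rw [hne i hik, h3 i hik', hs, Finset.prod_insert (by simp)]
          ring)
  rw [← mul_word] at key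
  rw [key.2.2 i i.2]
  simp

theorem IsCartanSeed.y_word_eq_iff (h : E.IsCartanSeed t₀ π A) (b : E.XPos) :
    b.y (t₀ * word (List.ofFn π)) = b.y t₀ ↔ bigY A (fun i => b.y t₀ (π i)) ∈ solX A := by
  have hy := h.y_word b
  have hYpos : ∀ i, 0 < bigY A (fun i => b.y t₀ (π i)) i := bigY_pos A fun i => b.pos _ _
  have hYeq := bigY_eq A (fun i => b.y t₀ (π i))
  generalize bigY A (fun i => b.y t₀ (π i)) = Y at *
  have hsplit : ∀ i, ∏ j ∈ Finset.univ.erase i, (1 + Y j) ^ (-A j i) =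
      (∏ j with i < j, (1 + Y j) ^ (-A j i)) * ∏ j with j < i, (1 + Y j) ^ (-A j i) := fun i => by
    rw [← Finset.prod_union (Finset.disjoint_filter.mpr fun j _ h1 h2 => lt_asymm h1 h2)]
    refine Finset.prod_congr ?_ fun _ _ => rfl
    ext j
    simp only [Finset.mem_erase, Finset.mem_univ, and_true, Finset.mem_union, Finset.mem_filter,
      true_and]
    exact ne_iff_lt_or_gt.trans or_comm
  have hiff : ∀ i, b.y (t₀ * word (List.ofFn π)) (π i) = b.y t₀ (π i) ↔
      Y i ^ 2 = ∏ j ∈ Finset.univ.erase i, (1 + Y j) ^ (-A j i) := fun i => by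
    have hp := (prod_one_add_pos hYpos (fun j => -A j i) (Finset.univ.filter (· < i))).ne'
    have hYi := (hYpos i).ne'
    rw [hy i, hsplit i, ← mul_left_inj' hp, ← hYeq i, sq, inv_mul_eq_div, div_mul_eq_mul_div,
      div_eq_iff hYi, eq_comm]
  constructor
  · intro hf
    exact ⟨hYpos, fun i => (hiff i).mp (congrFun hf _)⟩
  · rintro ⟨-, hs⟩
    funext i
    simpa using (hiff (π.symm i)).mpr (hs _)

end ClusterEnsemble

end ClusterDT

theorem theoremA {n : ℕ} (E : ClusterDT.ClusterEnsemble n) (hE : E.IsFiniteType) :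
    (∃ t₀ π A, E.IsCartanSeed t₀ π A) ∧
    ∀ (t₀ : ClusterDT.Tree n) (π : Equiv.Perm (Fin n)) (A : Matrix (Fin n) (Fin n) ℤ),
      E.IsCartanSeed t₀ π A →
      ∃ h : E.IsReddeningTriple t₀ (t₀ * ClusterDT.word (List.ofFn π)) 1,
        -- unique positive fixed points, matched by the ensemble map
        (∃ (a : E.APos) (b : E.XPos),
          (∀ a' : E.APos, ClusterDT.ClusterEnsemble.DTA h a' = a' ↔ a' = a) ∧
          (∀ b' : E.XPos, ClusterDT.ClusterEnsemble.DTX h b' = b' ↔ b' = b) ∧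
          E.p a = b) ∧
        -- fixed points correspond to positive solutions
        Set.BijOn (fun (a : E.APos) i => a.x t₀ (π i))
          {a | ClusterDT.ClusterEnsemble.DTA h a = a} (ClusterDT.solA A) ∧
        Set.BijOn (fun (b : E.XPos) => ClusterDT.bigY A (fun i => b.y t₀ (π i)))
          {b | ClusterDT.ClusterEnsemble.DTX h b = b} (ClusterDT.solX A) ∧
        (∀ a ∈ ClusterDT.solA A, (fun i => a i ^ 2 - 1) ∈ ClusterDT.solX A) ∧
        -- each system has a unique positive solution
        (∃! a, a ∈ ClusterDT.solA A) ∧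
        (∃! b, b ∈ ClusterDT.solX A) := by
  open ClusterDT ClusterDT.ClusterEnsemble in
  constructor
  · obtain ⟨t, ht⟩ := hE
    obtain ⟨π, A, hA, hB⟩ := exists_perm_cartanB (E.skew t) ht
    exact ⟨t, π, A, hA, hB⟩
  intro t₀ π A hseed
  have hred := hseed.isReddeningTriple
  obtain ⟨a₀, ha₀⟩ := solA_nonempty hseed.1
  have hA1 := solA_subsingleton hseed.1
  have hX1 := solX_subsingleton hseed.1
  have hfixA : ∀ a : E.APos, DTA hred a = a ↔ (fun i => a.x t₀ (π i)) ∈ solA A := fun a =>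
    (DTA_eq_self_iff hred a).trans (hseed.x_word_eq_iff a)
  have hfixX : ∀ b : E.XPos, DTX hred b = b ↔ bigY A (fun i => b.y t₀ (π i)) ∈ solX A := fun b =>
    (DTX_eq_self_iff hred b).trans (hseed.y_word_eq_iff b)
  have hbijA : Set.BijOn (fun (a : E.APos) i => a.x t₀ (π i)) {a | DTA hred a = a} (solA A) := by
    refine ⟨fun a ha => (hfixA a).mp ha, fun a _ a' _ haa => ?_, fun c hc => ?_⟩
    · refine APos.ext_cluster t₀ (funext fun i => ?_)
      simpa using congrFun haa (π.symm i)
    · obtain ⟨a, ha⟩ := E.exists_aPos t₀ (fun i => c (π.symm i)) fun i => hc.1 _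
      have hac : (fun i => a.x t₀ (π i)) = c := by
        funext i
        simp [ha]
      exact ⟨a, (hfixA a).mpr (hac ▸ hc), hac⟩
  have hbijX : Set.BijOn (fun (b : E.XPos) => bigY A (fun i => b.y t₀ (π i)))
      {b | DTX hred b = b} (solX A) := by
    refine ⟨fun b hb => (hfixX b).mp hb, fun b _ b' _ hbb => ?_, fun c hc => ?_⟩
    · refine XPos.ext_cluster t₀ (funext fun i => ?_)
      have h := bigY_injOn A (fun i => b.pos t₀ (π i)) (fun i => b'.pos t₀ (π i)) hbb
      simpa using congrFun h (π.symm i)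
    · obtain ⟨y, hy, hyc⟩ := exists_bigY_eq A hc.1
      obtain ⟨b, hb⟩ := E.exists_xPos t₀ (fun i => y (π.symm i)) fun i => hy _
      have hbc : bigY A (fun i => b.y t₀ (π i)) = c := by
        simpa [hb] using hyc
      exact ⟨b, (hfixX b).mpr (hbc ▸ hc), hbc⟩
  refine ⟨hred, ?_, hbijA, hbijX, fun a ha => sq_sub_one_mem_solX ha,
    ⟨a₀, ha₀, fun c hc => hA1 hc ha₀⟩,
    ⟨_, sq_sub_one_mem_solX ha₀, fun c hc => hX1 hc (sq_sub_one_mem_solX ha₀)⟩⟩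
  obtain ⟨a, ha, -⟩ := hbijA.surjOn ha₀
  have hpa : DTX hred (E.p a) = E.p a := by
    rw [← p_DTA, ha]
  refine ⟨a, E.p a, fun a' => ⟨fun ha' => ?_, fun ha' => ha' ▸ ha⟩,
    fun b' => ⟨fun hb' => ?_, fun hb' => hb' ▸ hpa⟩, rfl⟩
  · exact hbijA.injOn ha' ha (hA1 (hbijA.mapsTo ha') (hbijA.mapsTo ha))
  · exact hbijX.injOn hb' hpa (hX1 (hbijX.mapsTo hb') (hbijX.mapsTo hpa))
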